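/- Let $(\Sigma,g)$ be a smooth compact connected 3-dimensional Riemannian manifold with boundary $\partial\Sigma$, and let $\bar g$ be the metric induced by $g$ on $\partial\Sigma$. Let $\mathbb S^2\subset\mathbb R^3$ be the unit sphere with its round metric $g_{\mathbb S}$, and let $\Phi:\partial\Sigma\to\mathbb S^2$ be a conformal isomorphism, i.e. a smooth diffeomorphism for which there is a function $\phi:\partial\Sigma\to(0,\infty)$ with $\phi^{-2}\bar g=\Phi^*g_{\mathbb S}$. Let $x^1,x^2,x^3$ be smooth functions on $\Sigma$ (up to the boundary) such that $\Delta_g x^i=0$ on $\Sigma$ and $x^i=x^i_{\mathbb S}\circ\Phi$ on $\partial\Sigma$ for $i=1,2,3$, where $x^i_{\mathbb S}$ are the restrictions to $\mathbb S^2$ of the Cartesian coordinates of $\mathbb R^3$ and $\Delta_g$ is the Laplace–Beltrami operator. Suppose that $$\Big|\sum_{i=1}^3\nabla x^i\otimes\nabla x^i-g\Big|<1\quad\text{everywhere on }\Sigma,$$ where $|T|=(g^{ik}g^{jl}T_{ij}T_{kl})^{1/2}$ is the norm of a covariant 2-tensor $T$ with respect to $g$. Then the map $p\mapsto(x^1(p),x^2(p),x^3(p))$,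 which extends $\Phi$ to $\Sigma$, is a diffeomorphism from $\Sigma$ onto the closed unit ball $\mathbb D^3=\{y\in\mathbb R^3:|y|\le1\}$: it is smooth and maps $\Sigma$ bijectively onto $\mathbb D^3$, and its inverse is smooth on $\mathbb D^3$ up to the boundary. -/

import Mathlib

open Set Manifold
open scoped ContDiff Topology

noncomputable section

namespace ManifoldWithBoundary

/-- Euclidean three-space. -/
abbrev E3 := EuclideanSpace ℝ (Fin 3)

/-- The Euclidean plane. -/
abbrev E2 := EuclideanSpace ℝ (Fin 2)

/-! ### The boundary of a smooth 3-manifold with boundary, as a smooth surface -/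

/-- The points of the boundary of a 3-manifold with boundary. -/
abbrev Bdry (M : Type*) [TopologicalSpace M] [ChartedSpace (EuclideanHalfSpace 3) M] : Type _ :=
  ↥((𝓡∂ 3).boundary M)

/-- `(a, b) ↦ (0, a, b)`, the inclusion of the plane into three-space as the hyperplane bounding
the half-space. -/
def planeIncl (y : E2) : E3 := !₂[0, y 0, y 1]

/-- `(a, b) ↦ (0, a, b)`, with values in the half-space. -/
def planeInclHalf (y : E2) : EuclideanHalfSpace 3 := ⟨planeIncl y, by simp [planeIncl]⟩

/-- `(t, a, b) ↦ (a, b)`. -/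
def planeProj (z : E3) : E2 := !₂[z 1, z 2]

theorem contDiff_planeIncl : ContDiff ℝ ∞ planeIncl := by
  rw [contDiff_euclidean]
  intro i
  fin_cases i <;> simp [planeIncl] <;> fun_prop

theorem contDiff_planeProj : ContDiff ℝ ∞ planeProj := by
  rw [contDiff_euclidean]
  intro i
  fin_cases i <;> simp [planeProj] <;> fun_prop

theorem continuous_planeInclHalf : Continuous planeInclHalf :=
  contDiff_planeIncl.continuous.subtype_mk _

theorem planeProj_planeIncl (y : E2) : planeProj (planeIncl y) = y := by
  ext i
  fin_cases i <;> simp [planeProj, planeIncl]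

theorem planeIncl_planeProj {z : E3} (hz : z 0 = 0) : planeIncl (planeProj z) = z := by
  ext i
  fin_cases i <;> simp [planeProj, planeIncl, hz]

section Boundary

variable {M : Type*} [TopologicalSpace M] [ChartedSpace (EuclideanHalfSpace 3) M]

theorem mem_boundary_iff [IsManifold (𝓡∂ 3) ∞ M] (p : M) {q : M}
    (hq : q ∈ (chartAt (EuclideanHalfSpace 3) p).source) :
    q ∈ (𝓡∂ 3).boundary M ↔ (chartAt (EuclideanHalfSpace 3) p q).1 0 = 0 := by
  have h1 := (𝓡∂ 3).isInteriorPoint_iff_of_mem_atlas (n := ∞) (M := M) (by simp)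
    (chart_mem_atlas (EuclideanHalfSpace 3) p) hq
  have h2 : q ∈ (𝓡∂ 3).boundary M ↔ ¬ (𝓡∂ 3).IsInteriorPoint q :=
    (𝓡∂ 3).isBoundaryPoint_iff_not_isInteriorPoint q
  have h3 : (chartAt (EuclideanHalfSpace 3) p).extend (𝓡∂ 3) q ∈
      interior ((chartAt (EuclideanHalfSpace 3) p).extend (𝓡∂ 3)).target ↔
      0 < (chartAt (EuclideanHalfSpace 3) p q).1 0 := by
    constructor
    · intro h
      have h' := OpenPartialHomeomorph.interior_extend_target_subset_interior_range _ h
      rw [interior_range_modelWithCornersEuclideanHalfSpace] at h'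
      exact h'
    · intro h
      refine (chartAt (EuclideanHalfSpace 3) p).mem_interior_extend_target
        ((chartAt (EuclideanHalfSpace 3) p).map_source hq) ?_
      rw [interior_range_modelWithCornersEuclideanHalfSpace]
      exact h
  rw [h2, h1, h3]
  have h4 : 0 ≤ (chartAt (EuclideanHalfSpace 3) p q).1 0 := (chartAt (EuclideanHalfSpace 3) p q).2
  constructor
  · intro h; linarith
  · intro h; linarith

theorem symm_planeInclHalf_mem_boundary [IsManifold (𝓡∂ 3) ∞ M] (p : M) {y : E2}
    (hy : planeInclHalf y ∈ (chartAt (EuclideanHalfSpace 3) p).target) :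
    (chartAt (EuclideanHalfSpace 3) p).symm (planeInclHalf y) ∈ (𝓡∂ 3).boundary M := by
  rw [mem_boundary_iff p ((chartAt (EuclideanHalfSpace 3) p).map_target hy),
    (chartAt (EuclideanHalfSpace 3) p).right_inv hy]
  simp [planeInclHalf, planeIncl]

theorem planeInclHalf_planeProj_chart [IsManifold (𝓡∂ 3) ∞ M] (p : M) {q : M}
    (hq : q ∈ (chartAt (EuclideanHalfSpace 3) p).source) (hb : q ∈ (𝓡∂ 3).boundary M) :
    planeInclHalf (planeProj (chartAt (EuclideanHalfSpace 3) p q).1) =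
      chartAt (EuclideanHalfSpace 3) p q := by
  apply Subtype.ext
  exact planeIncl_planeProj ((mem_boundary_iff p hq).1 hb)

open Classical in
/-- The boundary chart at `p`: the restriction to the boundary of the chart of the manifold at `p`,
which maps the boundary to the hyperplane bounding the half-space. -/
def bdryChart [IsManifold (𝓡∂ 3) ∞ M] (p : Bdry M) : OpenPartialHomeomorph (Bdry M) E2 where
  toFun q := planeProj (chartAt (EuclideanHalfSpace 3) p.1 q.1).1
  invFun y := if hy : planeInclHalf y ∈ (chartAt (EuclideanHalfSpace 3) p.1).target then
    ⟨(chartAt (EuclideanHalfSpace 3) p.1).symm (planeInclHalf y),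
      symm_planeInclHalf_mem_boundary p.1 hy⟩ else p
  source := {q | q.1 ∈ (chartAt (EuclideanHalfSpace 3) p.1).source}
  target := {y | planeInclHalf y ∈ (chartAt (EuclideanHalfSpace 3) p.1).target}
  map_source' q hq := by
    simp only [mem_ofPred_eq] at hq ⊢
    rw [planeInclHalf_planeProj_chart p.1 hq q.2]
    exact (chartAt (EuclideanHalfSpace 3) p.1).map_source hq
  map_target' y hy := by
    simp only [mem_ofPred_eq] at hy ⊢
    rw [dif_pos hy]
    exact (chartAt (EuclideanHalfSpace 3) p.1).map_target hy
  left_inv' q hq := by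
    simp only [mem_ofPred_eq] at hq
    apply Subtype.ext
    have h := planeInclHalf_planeProj_chart p.1 hq q.2
    have h' := (chartAt (EuclideanHalfSpace 3) p.1).map_source hq
    simp only [h, h', dite_true]
    exact (chartAt (EuclideanHalfSpace 3) p.1).left_inv hq
  right_inv' y hy := by
    simp only [mem_ofPred_eq] at hy
    simp only [hy, dite_true]
    rw [(chartAt (EuclideanHalfSpace 3) p.1).right_inv hy]
    exact planeProj_planeIncl y
  open_source := (chartAt (EuclideanHalfSpace 3) p.1).open_source.preimage continuous_subtype_val
  open_target :=
    (chartAt (EuclideanHalfSpace 3) p.1).open_target.preimage continuous_planeInclHalf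
  continuousOn_toFun := by
    refine contDiff_planeProj.continuous.comp_continuousOn
      (continuous_subtype_val.comp_continuousOn ?_)
    exact (chartAt (EuclideanHalfSpace 3) p.1).continuousOn.comp
      continuous_subtype_val.continuousOn (fun q hq => hq)
  continuousOn_invFun := by
    rw [Topology.IsInducing.subtypeVal.continuousOn_iff]
    refine ((chartAt (EuclideanHalfSpace 3) p.1).continuousOn_symm.comp
      continuous_planeInclHalf.continuousOn (fun y hy => hy)).congr ?_
    intro y hy
    have hy' : planeInclHalf y ∈ (chartAt (EuclideanHalfSpace 3) p.1).target := hy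
    simp [hy']

/-- The boundary is a surface, with the boundary charts as atlas. -/
instance instChartedSpaceBdry [IsManifold (𝓡∂ 3) ∞ M] : ChartedSpace E2 (Bdry M) where
  atlas := range bdryChart
  chartAt := bdryChart
  mem_chart_source p := mem_chart_source (EuclideanHalfSpace 3) p.1
  chart_mem_atlas p := mem_range_self p

/-- The boundary is a smooth surface. -/
instance instIsManifoldBdry [IsManifold (𝓡∂ 3) ∞ M] : IsManifold (𝓡 2) ∞ (Bdry M) := by
  apply isManifold_of_contDiffOn
  rintro _ _ ⟨p, rfl⟩ ⟨q, rfl⟩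
  have h := (𝓡∂ 3).contDiffOn_extendCoordChange (n := ∞)
    (IsManifold.subset_maximalAtlas (chart_mem_atlas (EuclideanHalfSpace 3) p.1))
    (IsManifold.subset_maximalAtlas (chart_mem_atlas (EuclideanHalfSpace 3) q.1))
  have hsymm (y : E2) : (𝓡∂ 3).symm (planeIncl y) = planeInclHalf y :=
    (𝓡∂ 3).left_inv (planeInclHalf y)
  have key (y : E2) (hy : y ∈ (𝓡 2).symm ⁻¹' ((bdryChart p).symm ≫ₕ bdryChart q).source) :
      planeInclHalf y ∈ (chartAt (EuclideanHalfSpace 3) p.1).target ∧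
      (chartAt (EuclideanHalfSpace 3) p.1).symm (planeInclHalf y) ∈
        (chartAt (EuclideanHalfSpace 3) q.1).source := by
    obtain ⟨h1, h2⟩ := hy
    have h1' : planeInclHalf y ∈ (chartAt (EuclideanHalfSpace 3) p.1).target := h1
    refine ⟨h1', ?_⟩
    have h2' : ((bdryChart p).symm y).1 ∈ (chartAt (EuclideanHalfSpace 3) q.1).source := h2
    simpa [bdryChart, h1'] using h2'
  refine (contDiff_planeProj.comp_contDiffOn
    (h.comp contDiff_planeIncl.contDiffOn ?_)).congr ?_
  · intro y hy
    obtain ⟨h1, h2⟩ := key y hy.1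
    have h3 : planeIncl y ∈ range (𝓡∂ 3) := ⟨planeInclHalf y, rfl⟩
    simp [ModelWithCorners.extendCoordChange, OpenPartialHomeomorph.extend, hsymm, h1, h2]
    exact h3
  · intro y hy
    obtain ⟨h1, h2⟩ := key y hy.1
    simp [bdryChart, h1, ModelWithCorners.extendCoordChange, hsymm]

/-- The inclusion of the boundary is smooth. -/
theorem contMDiff_bdry_val [IsManifold (𝓡∂ 3) ∞ M] :
    ContMDiff (𝓡 2) (𝓡∂ 3) ∞ (Subtype.val : Bdry M → M) := by
  intro p
  rw [contMDiffAt_iff]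
  refine ⟨continuous_subtype_val.continuousAt, ?_⟩
  refine (contDiff_planeIncl.contDiffWithinAt).congr_of_eventuallyEq_of_mem ?_ (by simp)
  simp only [modelWithCornersSelf_coe, range_id, nhdsWithin_univ]
  have hmem : (bdryChart p).target ∈ 𝓝 (extChartAt (𝓡 2) p p) :=
    (bdryChart p).open_target.mem_nhds ((bdryChart p).map_source (mem_chart_source E2 p))
  filter_upwards [hmem] with y hy
  have hy' : planeInclHalf y ∈ (chartAt (EuclideanHalfSpace 3) p.1).target := hy
  have h1 : ((extChartAt (𝓡 2) p).symm y).1 =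
      (chartAt (EuclideanHalfSpace 3) p.1).symm (planeInclHalf y) := by
    change ((bdryChart p).symm y).1 = _
    simp [bdryChart, hy']
  simp only [Function.comp_apply, h1]
  simp only [extChartAt, OpenPartialHomeomorph.extend, PartialEquiv.coe_trans, Function.comp_apply,
    OpenPartialHomeomorph.toFun_eq_coe, (chartAt (EuclideanHalfSpace 3) p.1).right_inv hy',
    ModelWithCorners.toPartialEquiv_coe]
  rfl

end Boundary

/-! ### Riemannian metrics: norms of 2-tensors and the Laplace-Beltrami operator -/

section Riemannian

variable {M : Type*} [TopologicalSpace M] [ChartedSpace (EuclideanHalfSpace 3) M]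
  [IsManifold (𝓡∂ 3) ∞ M]

variable (M) in
/-- Smooth Riemannian metrics on `M`. -/
abbrev SmoothMetric :=
  Bundle.ContMDiffRiemannianMetric (𝓡∂ 3) ∞ E3 (fun p : M => TangentSpace (𝓡∂ 3) p)

/-- The coordinate vector field `∂ᵢ` of the preferred chart at `p`, at the point with coordinates
`y`. -/
def coordField (p : M) (y : E3) (i : Fin 3) :
    TangentSpace (𝓡∂ 3) ((extChartAt (𝓡∂ 3) p).symm y) :=
  mfderivWithin 𝓘(ℝ, E3) (𝓡∂ 3) (extChartAt (𝓡∂ 3) p).symm (range (𝓡∂ 3)) y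
    (EuclideanSpace.single i (1 : ℝ) : E3)

/-- The matrix `(g_ij)` of the metric in the preferred chart at `p`, at the point with
coordinates `y`. -/
def metricCoeff (g : SmoothMetric M) (p : M) (y : E3) : Matrix (Fin 3) (Fin 3) ℝ :=
  Matrix.of fun i j =>
    g.inner ((extChartAt (𝓡∂ 3) p).symm y) (coordField p y i) (coordField p y j)

/-- The partial derivative `∂ᵢ` of a function of the coordinates; it is one-sided at boundary
points. -/
def partialDeriv (i : Fin 3) (u : E3 → ℝ) (y : E3) : ℝ :=
  fderivWithin ℝ u (range (𝓡∂ 3)) y (EuclideanSpace.single i (1 : ℝ))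

/-- The Laplace-Beltrami operator `Δ f = (det g)^(-1/2) ∂ᵢ ((det g)^(1/2) g^ij ∂ⱼ f)`, computed at
`p` in the preferred chart at `p`. -/
def laplacian (g : SmoothMetric M) (f : M → ℝ) (p : M) : ℝ :=
  (√(metricCoeff g p (extChartAt (𝓡∂ 3) p p)).det)⁻¹ *
    ∑ i, partialDeriv i (fun y => √(metricCoeff g p y).det *
      ∑ j, (metricCoeff g p y)⁻¹ i j * partialDeriv j (f ∘ (extChartAt (𝓡∂ 3) p).symm) y)
      (extChartAt (𝓡∂ 3) p p)

/-- The norm `|T| = (g^ik g^jl T_ij T_kl)^(1/2)` of a covariant 2-tensor at `p`, computed in the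
preferred chart at `p`. -/
def tensorNorm (g : SmoothMetric M) (p : M)
    (T : TangentSpace (𝓡∂ 3) p → TangentSpace (𝓡∂ 3) p → ℝ) : ℝ :=
  let e : Fin 3 → TangentSpace (𝓡∂ 3) p := fun i => (EuclideanSpace.single i (1 : ℝ) : E3)
  let G : Matrix (Fin 3) (Fin 3) ℝ := Matrix.of fun i j => g.inner p (e i) (e j)
  √(∑ i, ∑ j, ∑ k, ∑ l, G⁻¹ i k * G⁻¹ j l * T (e i) (e j) * T (e k) (e l))

/-- The tensor `∑ᵢ ∇xⁱ ⊗ ∇xⁱ - g` at `p`. -/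
def gramDefect (g : SmoothMetric M) (x : Fin 3 → M → ℝ) (p : M)
    (v w : TangentSpace (𝓡∂ 3) p) : ℝ :=
  ∑ i, mvfderiv (𝓡∂ 3) (x i) p v * mvfderiv (𝓡∂ 3) (x i) p w - g.inner p v w

/-! ### Conformal isomorphisms from the boundary to the round sphere -/

/-- The unit sphere of Euclidean three-space. -/
abbrev S2 : Type := ↥(Metric.sphere (0 : E3) 1)

/-- The metric induced by `g` on the boundary. -/
def bdryMetric (g : SmoothMetric M) (p : Bdry M) (v w : TangentSpace (𝓡 2) p) : ℝ :=
  g.inner p.1 (mfderiv (𝓡 2) (𝓡∂ 3) (Subtype.val : Bdry M → M) p v)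
    (mfderiv (𝓡 2) (𝓡∂ 3) (Subtype.val : Bdry M → M) p w)

/-- The round metric on the unit sphere, induced by the Euclidean metric. -/
def roundMetric (q : S2) (v w : TangentSpace (𝓡 2) q) : ℝ :=
  inner ℝ (mvfderiv (𝓡 2) (Subtype.val : S2 → E3) q v)
    (mvfderiv (𝓡 2) (Subtype.val : S2 → E3) q w)

/-- A diffeomorphism from the boundary to the sphere is a conformal isomorphism if
`φ⁻² g = Φ^* g_S` on the boundary for a positive function `φ`. -/
def IsConformalIso (g : SmoothMetric M) (Φ : Bdry M ≃ₘ⟮𝓡 2, 𝓡 2⟯ S2) : Prop :=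
  ∃ φ : Bdry M → ℝ, (∀ p, 0 < φ p) ∧ ∀ (p : Bdry M) (v w : TangentSpace (𝓡 2) p),
    (φ p ^ 2)⁻¹ * bdryMetric g p v w =
      roundMetric (Φ p) (mfderiv (𝓡 2) (𝓡 2) Φ p v) (mfderiv (𝓡 2) (𝓡 2) Φ p w)

/-- `F` is a diffeomorphism from `M` onto the subset `s` of three-space (for `s` the closure of a
smooth domain): it is smooth, and it is a bijection onto `s` with an inverse that is smooth on `s`
up to the boundary. -/
def IsDiffeomorphismOnto (F : M → E3) (s : Set E3) : Prop :=
  ContMDiff (𝓡∂ 3) 𝓘(ℝ, E3) ∞ F ∧ BijOn F univ s ∧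
    ∃ G : E3 → M, ContMDiffOn 𝓘(ℝ, E3) (𝓡∂ 3) ∞ G s ∧ ∀ p, G (F p) = p

end Riemannian

end ManifoldWithBoundary

end

open ManifoldWithBoundary

/-!
The bound on `∑ᵢ ∇xⁱ ⊗ ∇xⁱ - g` makes the differential of `F = (x¹, x², x³)` injective at every
point, since a vector `v` in its kernel would satisfy `(∑ᵢ ∇xⁱ ⊗ ∇xⁱ - g) v v = -g v v`, which forces
the norm to be at least `1` (`eq_zero_of_mvfderiv_eq_zero`). Hence `F` is open at interior points
(`map_nhds_eq_of_isInvertible_mfderiv`) and locally injective at every point, boundary points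
included (`exists_injOn_nhds_of_isInvertible_mfderiv`).

The rest is topology (`bijOn_closedBall_of_locally_injective`). The norm of `F` has no maximum at an
interior point because `F` is open there; as `F` maps the boundary onto the sphere, it maps the
interior into the open ball. The image of the interior is open and closed in the open ball, so `F`
is onto. The set of double values of `F` is compact by local injectivity; it misses the sphere, over
which the only preimages are boundary points, where `F` is the injective map `Φ`; so both preimages
of a double value are interior points and the set is open. A compact open subset of three-space is
empty, so `F` is injective.

The inverse is continuous by compactness. It is smooth up to the boundary by a bootstrap: in charts,
its derivative is the inverse of the derivative of `F` composed with the inverse of `F`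
(`ContDiffOn.of_rightInverse`).
-/

/-! ### One-sided inverse function theorem -/

/-- Local injectivity of `C¹` maps with invertible derivative, relative to a convex set; it applies
at boundary points of the set. The map `y ↦ y - A⁻¹ (f y)` has zero derivative at `a`, so convexity
makes it a contraction near `a`. -/
theorem exists_injOn_nhdsWithin_of_contDiffWithinAt {E F : Type*}
    [NormedAddCommGroup E] [NormedSpace ℝ E] [NormedAddCommGroup F] [NormedSpace ℝ F]
    {f : E → F} {s : Set E} {a : E} (hs : Convex ℝ s) (hs' : UniqueDiffOn ℝ s) (ha : a ∈ s)
    (hf : ContDiffWithinAt ℝ 1 f s a) {A : E ≃L[ℝ] F}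
    (hA : HasFDerivWithinAt f (A : E →L[ℝ] F) s a) :
    ∃ u ∈ 𝓝[s] a, InjOn f u := by
  have hd : ∀ᶠ y in 𝓝[s] a, DifferentiableWithinAt ℝ f s y := by
    have h := hf.eventually (by simp)
    rw [insert_eq_of_mem ha] at h
    exact h.mono fun y hy => hy.differentiableWithinAt one_ne_zero
  have hc : ContinuousWithinAt (fderivWithin ℝ f s) s a :=
    (hf.fderivWithin_right (m := 0) hs' (by simp) ha).continuousWithinAt
  have hA' : fderivWithin ℝ f s a = A := hA.fderivWithin (hs' a ha)
  let φ : E → E := fun y => y - A.symm (f y)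
  obtain ⟨u, hu, hL⟩ := hs.exists_nhdsWithin_lipschitzOnWith_of_hasFDerivWithinAt_of_nnnorm_lt
    (f := φ) (x := a)
    (f' := fun y => ContinuousLinearMap.id ℝ E - (A.symm : F →L[ℝ] E) ∘L fderivWithin ℝ f s y)
    (hd.mono fun y hy => (hasFDerivWithinAt_id y s).sub
      ((A.symm : F →L[ℝ] E).hasFDerivAt.comp_hasFDerivWithinAt y hy.hasFDerivWithinAt))
    (continuousWithinAt_const.sub
      ((continuousWithinAt_const (b := (A.symm : F →L[ℝ] E))).clm_comp hc)) (1 / 2)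
    (by simp [hA'])
  refine ⟨u, hu, fun y hy z hz hyz => ?_⟩
  have h := hL.dist_le_mul y hy z hz
  have h1 : dist (φ y) (φ z) = dist y z := by simp [φ, hyz, dist_eq_norm]
  rw [h1] at h
  have h2 : dist y z ≤ 0 := by
    norm_num at h
    linarith
  exact dist_le_zero.1 h2

/-- A continuous right inverse `h` of a smooth map with invertible derivatives is smooth. No
regularity of `t` is needed: the derivative of `h` is `(f' ∘ h)⁻¹`, which is as smooth as `h`. -/
theorem ContDiffOn.of_rightInverse {E F : Type*}
    [NormedAddCommGroup E] [NormedSpace ℝ E] [CompleteSpace E]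
    [NormedAddCommGroup F] [NormedSpace ℝ F]
    {f : E → F} {s : Set E} {h : F → E} {t : Set F} (hs : UniqueDiffOn ℝ s)
    (hf : ContDiffOn ℝ ∞ f s)
    (hA : ∀ x ∈ s, ∃ A : E ≃L[ℝ] F, HasFDerivWithinAt f (A : E →L[ℝ] F) s x)
    (hc : ContinuousOn h t) (hst : MapsTo h t s) (hfh : ∀ y ∈ t, f (h y) = y) :
    ContDiffOn ℝ ∞ h t := by
  have hd : ∀ y ∈ t, HasFDerivWithinAt h (fderivWithin ℝ f s (h y)).inverse t y := by
    intro y hy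
    obtain ⟨A, hA⟩ := hA (h y) (hst hy)
    rw [hA.fderivWithin (hs _ (hst hy)), ContinuousLinearMap.inverse_equiv]
    exact hA.of_local_left_inverse ((hc y hy).tendsto_nhdsWithin hst) hy
      (Filter.eventually_of_mem self_mem_nhdsWithin hfh)
  rw [contDiffOn_infty]
  intro n
  induction n with
  | zero => exact contDiffOn_zero.2 hc
  | succ n ih =>
    intro y hy
    push_cast
    rw [contDiffWithinAt_succ_iff_hasFDerivWithinAt (by simp)]
    refine ⟨t, by simp [insert_eq_of_mem hy, self_mem_nhdsWithin], by simp, _, hd, ?_⟩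
    obtain ⟨A, hA⟩ := hA (h y) (hst hy)
    have h1 : ContDiffAt ℝ n ContinuousLinearMap.inverse (fderivWithin ℝ f s (h y)) := by
      rw [hA.fderivWithin (hs _ (hst hy))]
      exact contDiffAt_map_inverse A
    have h2 : ContDiffOn ℝ n (fderivWithin ℝ f s) s := hf.fderivWithin hs (by exact_mod_cast le_top)
    exact h1.comp_contDiffWithinAt y (h2.comp ih hst y hy)

/-! ### Local homeomorphisms onto the ball -/

/-- A map from a compact space to a normed space that is locally injective everywhere, open off a
set `B`, and maps `B` bijectively onto the unit sphere is a bijection onto the closed unit ball. -/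
theorem bijOn_closedBall_of_locally_injective {M E : Type*} [TopologicalSpace M] [T2Space M]
    [CompactSpace M] [NormedAddCommGroup E] [NormedSpace ℝ E] [Nontrivial E] [ProperSpace E]
    {F : M → E} {B : Set M} (hF : Continuous F) (hinj : ∀ p, ∃ u ∈ 𝓝 p, InjOn F u)
    (hopen : ∀ p ∉ B, Filter.map F (𝓝 p) = 𝓝 (F p)) (hne : Bᶜ.Nonempty)
    (hB : BijOn F B (Metric.sphere 0 1)) :
    BijOn F univ (Metric.closedBall 0 1) := by
  -- As `F` is open off `B`, its norm is maximal only on `B`; so `F` maps into the closed ball, and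
  -- maps the complement of `B` into the open ball.
  have hmax (p : M) (hp : p ∉ B) : ∃ q, ‖F p‖ < ‖F q‖ := by
    by_contra! h
    have h1 : Metric.closedBall (0 : E) ‖F p‖ ∈ 𝓝 (F p) := by
      rw [← hopen p hp, Filter.mem_map]
      filter_upwards with q
      simpa using h q
    have h2 := mem_interior_iff_mem_nhds.2 h1
    rw [interior_closedBall'] at h2
    simp at h2
  obtain ⟨p₁, -, hp₁⟩ := isCompact_univ.exists_isMaxOn ⟨_, mem_univ hne.some⟩
    hF.norm.continuousOn
  have hp₁B : p₁ ∈ B := by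
    by_contra h
    obtain ⟨q, hq⟩ := hmax p₁ h
    exact absurd (hp₁ (mem_univ q)) (not_le.2 hq)
  have hle (p : M) : ‖F p‖ ≤ 1 := by
    have h1 : ‖F p‖ ≤ ‖F p₁‖ := hp₁ (mem_univ p)
    have h2 : ‖F p₁‖ = 1 := by simpa using hB.mapsTo hp₁B
    exact h1.trans h2.le
  have hlt (p : M) (hp : p ∉ B) : ‖F p‖ < 1 := by
    obtain ⟨q, hq⟩ := hmax p hp
    exact hq.trans_le (hle q)
  have heq (p : M) (hp : p ∈ B) : ‖F p‖ = 1 := by simpa using hB.mapsTo hp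
  have hmem (p : M) (hp : ‖F p‖ < 1) : p ∉ B := fun h => hp.ne (heq p h)
  refine ⟨fun p _ => by simpa using hle p, ?_, ?_⟩
  · -- The set `C` of pairs of distinct points with the same image is closed by local injectivity.
    -- Its image `T`, the set of double points, is compact, and it is open since it misses the
    -- sphere. A clopen compact subset of the noncompact connected space `E` is empty.
    let C : Set (M × M) := {z | z.1 ≠ z.2 ∧ F z.1 = F z.2}
    have hC : IsClosed C := by
      rw [← isOpen_compl_iff, isOpen_iff_mem_nhds]
      rintro ⟨p, q⟩ hpq
      by_cases h : F p = F q
      · have hpq' : p = q := by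
          by_contra h'
          exact hpq ⟨h', h⟩
        subst hpq'
        obtain ⟨u, hu, hui⟩ := hinj p
        filter_upwards [prod_mem_nhds hu hu] with z hz hz'
        exact hz'.1 (hui hz.1 hz.2 hz'.2)
      · have h' : {z : M × M | F z.1 ≠ F z.2} ∈ 𝓝 (p, q) :=
          (isOpen_ne_fun (by fun_prop) (by fun_prop)).mem_nhds h
        filter_upwards [h'] with z hz hz'
        exact hz hz'.2
    let T : Set E := (fun z : M × M => F z.1) '' C
    have hT : IsCompact T := hC.isCompact.image (by fun_prop)
    have hT' : IsOpen T := by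
      rw [isOpen_iff_mem_nhds]
      rintro _ ⟨⟨p, q⟩, ⟨hpq, hpq'⟩, rfl⟩
      simp only at hpq hpq' ⊢
      -- A double point on the sphere would come from two points of `B`, where `F` is injective.
      have hp : p ∉ B := by
        intro hp
        have hq : q ∈ B := by
          by_contra hq
          have := hlt q hq
          rw [← hpq', heq p hp] at this
          exact lt_irrefl _ this
        exact hpq (hB.injOn hp hq hpq')
      have hq : q ∉ B := hmem q (hpq' ▸ hlt p hp)
      obtain ⟨u, v, hu, hv, hpu, hqv, huv⟩ := t2_separation hpq
      have h1 : F '' u ∈ 𝓝 (F p) := by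
        rw [← hopen p hp]; exact Filter.image_mem_map (hu.mem_nhds hpu)
      have h2 : F '' v ∈ 𝓝 (F p) := by
        rw [hpq', ← hopen q hq]; exact Filter.image_mem_map (hv.mem_nhds hqv)
      filter_upwards [h1, h2]
      rintro _ ⟨a, ha, rfl⟩ ⟨b, hb, hab⟩
      exact ⟨(a, b), ⟨huv.ne_of_mem ha hb, hab.symm⟩, rfl⟩
    have hT0 : T = ∅ := by
      rcases isClopen_iff.1 ⟨hT.isClosed, hT'⟩ with h | h
      · exact h
      · exact absurd (h ▸ hT) (NormedSpace.noncompactSpace ℝ E).noncompact_univ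
    intro p _ q _ hpq
    by_contra h
    have : F p ∈ T := ⟨(p, q), ⟨h, hpq⟩, rfl⟩
    simp [hT0] at this
  · -- The image of the complement of `B` is closed and open in the open ball.
    have hball : Metric.ball (0 : E) 1 ⊆ range F := by
      let V : Set E := F '' Bᶜ
      have hV : IsOpen V := by
        rw [isOpen_iff_mem_nhds]
        rintro _ ⟨p, hp, rfl⟩
        have hn : {q | ‖F q‖ < 1} ∈ 𝓝 p :=
          (isOpen_lt hF.norm continuous_const).mem_nhds (hlt p hp)
        rw [← hopen p hp]
        exact Filter.mem_of_superset (Filter.image_mem_map hn) (image_mono fun q hq => hmem q hq)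
      have hsub := (convex_ball (0 : E) 1).isPreconnected.subset_left_of_subset_union
        (u := V) (v := (range F)ᶜ) hV (isCompact_range hF).isClosed.isOpen_compl
        (by
          rw [disjoint_compl_right_iff_subset]
          exact image_subset_range _ _)
        (fun y hy => by
          by_cases h : y ∈ range F
          · obtain ⟨p, rfl⟩ := h
            exact Or.inl ⟨p, hmem p (by simpa using hy), rfl⟩
          · exact Or.inr h)
        (by
          obtain ⟨p, hp⟩ := hne
          exact ⟨F p, by simpa using hlt p hp, p, hp, rfl⟩)
      exact hsub.trans (image_subset_range _ _)
    rw [SurjOn, image_univ, ← Metric.ball_union_sphere]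
    exact union_subset hball (hB.surjOn.trans (image_subset_range _ _))

/-! ### The norm of a 2-tensor bounds its values -/

open Matrix in
/-- If `T v v = -G v v` for some `v ≠ 0`, then `T` has norm at least `1` with respect to `G`. With
`G⁻¹ = Sᵀ S`, the sum is the squared Frobenius norm of `N = S T Sᵀ`, and `w = S G v` satisfies
`w · N w = -w · w`, so the Cauchy-Schwarz inequality applies. -/
theorem one_le_sum_inv_mul_of_neg_eq {n : Type*} [Fintype n] [DecidableEq n]
    {G T : Matrix n n ℝ} (hG : G.PosDef) {v : n → ℝ} (hv : v ≠ 0)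
    (hT : v ⬝ᵥ T *ᵥ v = -(v ⬝ᵥ G *ᵥ v)) :
    1 ≤ ∑ i, ∑ j, ∑ k, ∑ l, G⁻¹ i k * G⁻¹ j l * T i j * T k l := by
  obtain ⟨S, hS⟩ : ∃ S : Matrix n n ℝ, G⁻¹ = Sᵀ * S := by
    open scoped MatrixOrder ComplexOrder in
    obtain ⟨S, hS⟩ := CStarAlgebra.nonneg_iff_eq_star_mul_self.mp hG.inv.posSemidef.nonneg
    exact ⟨S, by simpa [Matrix.star_eq_conjTranspose] using hS⟩
  have hdet : IsUnit G.det := (Matrix.isUnit_iff_isUnit_det G).1 hG.isUnit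
  let N := S * T * Sᵀ
  let w := S *ᵥ (G *ᵥ v)
  have hSw : Sᵀ *ᵥ w = v := by
    simp only [w, mulVec_mulVec, ← Matrix.mul_assoc, ← hS]
    rw [Matrix.nonsing_inv_mul G hdet, one_mulVec]
  have hww : w ⬝ᵥ w = v ⬝ᵥ G *ᵥ v := by
    conv_lhs => rw [show w ⬝ᵥ w = w ⬝ᵥ S *ᵥ (G *ᵥ v) from rfl]
    rw [dotProduct_mulVec, ← mulVec_transpose, hSw]
  have hwN : w ⬝ᵥ N *ᵥ w = -(w ⬝ᵥ w) := by
    rw [hww, ← hT]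
    simp only [N, ← mulVec_mulVec, hSw]
    rw [dotProduct_mulVec, ← mulVec_transpose, hSw]
  have hpos : 0 < w ⬝ᵥ w := by
    rw [hww]
    simpa using hG.dotProduct_mulVec_pos hv
  have hsum : ∑ i, ∑ j, ∑ k, ∑ l, G⁻¹ i k * G⁻¹ j l * T i j * T k l = (N * Nᵀ).trace := by
    have h1 : (N * Nᵀ).trace = (T * G⁻¹ * Tᵀ * G⁻¹).trace := by
      have : N * Nᵀ = S * (T * (Sᵀ * S) * Tᵀ * Sᵀ) := by
        simp [N, Matrix.mul_assoc]
      rw [this, Matrix.trace_mul_comm, hS]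
      simp only [Matrix.mul_assoc]
    have hGs : ∀ i j, G⁻¹ i j = G⁻¹ j i := fun i j => by
      have hs : (Sᵀ * S)ᵀ = Sᵀ * S := by simp
      rw [hS]
      exact (congrFun₂ hs i j).symm
    rw [h1]
    simp only [Matrix.trace, Matrix.diag, Matrix.mul_apply, Matrix.transpose_apply,
      Finset.sum_mul]
    refine Finset.sum_congr rfl fun i _ => ?_
    rw [Finset.sum_comm]
    refine Finset.sum_congr rfl fun k _ => ?_
    rw [Finset.sum_comm]
    refine Finset.sum_congr rfl fun l _ => Finset.sum_congr rfl fun j _ => ?_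
    rw [hGs i k]
    ring
  have hN : (N * Nᵀ).trace = ∑ z : n × n, N z.1 z.2 ^ 2 := by
    rw [Fintype.sum_prod_type]
    simp [Matrix.trace, Matrix.mul_apply, pow_two]
  have hCS := Finset.sum_mul_sq_le_sq_mul_sq Finset.univ (fun z : n × n => N z.1 z.2)
    (fun z => w z.1 * w z.2)
  have h1 : ∑ z : n × n, N z.1 z.2 * (w z.1 * w z.2) = w ⬝ᵥ N *ᵥ w := by
    rw [Fintype.sum_prod_type]
    simp only [dotProduct, mulVec, Finset.mul_sum]
    exact Finset.sum_congr rfl fun i _ => Finset.sum_congr rfl fun j _ => by ring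
  have h2 : ∑ z : n × n, (w z.1 * w z.2) ^ 2 = (w ⬝ᵥ w) ^ 2 := by
    rw [Fintype.sum_prod_type, pow_two, dotProduct, Finset.sum_mul_sum]
    exact Finset.sum_congr rfl fun i _ => Finset.sum_congr rfl fun j _ => by ring
  rw [h1, h2, hwN, ← hN, ← hsum, neg_sq] at hCS
  exact le_of_mul_le_mul_right (by simpa using hCS) (pow_pos hpos 2)

/-! ### Maps with invertible derivative on a manifold with boundary -/

section LocalDiffeomorphism

variable {E E' H M : Type*} [NormedAddCommGroup E] [NormedSpace ℝ E]
  [NormedAddCommGroup E'] [NormedSpace ℝ E'] [TopologicalSpace H] {I : ModelWithCorners ℝ E H}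
  [TopologicalSpace M] [ChartedSpace H M] [IsManifold I ∞ M] {F : M → E'}

theorem exists_equiv_hasFDerivWithinAt_comp_extChartAt_symm (hF : ContMDiff I 𝓘(ℝ, E') ∞ F)
    (hd : ∀ p, (mfderiv I 𝓘(ℝ, E') F p).IsInvertible) (p : M) {y : E}
    (hy : y ∈ (extChartAt I p).target) :
    ∃ A : E ≃L[ℝ] E', HasFDerivWithinAt (F ∘ (extChartAt I p).symm) (A : E →L[ℝ] E')
      (range I) y := by
  have : IsManifold I 1 M := IsManifold.of_le (n := ∞) (by simp)
  have h1 := (mdifferentiableWithinAt_extChartAt_symm (I := I) hy).hasMFDerivWithinAt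
  have h2 := (hF.mdifferentiable (by simp) ((extChartAt I p).symm y)).hasMFDerivAt
  have h3 := h2.comp_hasMFDerivWithinAt y h1
  obtain ⟨A, hA⟩ := hd ((extChartAt I p).symm y)
  obtain ⟨B, hB⟩ := isInvertible_mfderivWithin_extChartAt_symm (I := I) hy
  rw [← hA, ← hB] at h3
  exact ⟨B.trans A, h3.hasFDerivWithinAt⟩

theorem contDiffOn_comp_extChartAt_symm (hF : ContMDiff I 𝓘(ℝ, E') ∞ F) (p : M) :
    ContDiffOn ℝ ∞ (F ∘ (extChartAt I p).symm) (extChartAt I p).target :=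
  (hF.comp_contMDiffOn (contMDiffOn_extChartAt_symm p)).contDiffOn

theorem exists_injOn_nhds_of_isInvertible_mfderiv (hF : ContMDiff I 𝓘(ℝ, E') ∞ F)
    (hd : ∀ p, (mfderiv I 𝓘(ℝ, E') F p).IsInvertible) (p : M) : ∃ u ∈ 𝓝 p, InjOn F u := by
  obtain ⟨A, hA⟩ := exists_equiv_hasFDerivWithinAt_comp_extChartAt_symm hF hd p
    (mem_extChartAt_target p)
  have hf : ContDiffWithinAt ℝ ∞ (F ∘ (extChartAt I p).symm) (range I) (extChartAt I p p) :=
    (contDiffOn_comp_extChartAt_symm hF p _ (mem_extChartAt_target p)).mono_of_mem_nhdsWithin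
      (extChartAt_target_mem_nhdsWithin p)
  obtain ⟨u, hu, hui⟩ := exists_injOn_nhdsWithin_of_contDiffWithinAt I.convex_range I.uniqueDiffOn
    (mem_range_self _) (hf.of_le (by simp)) hA
  refine ⟨(extChartAt I p).symm '' (u ∩ (extChartAt I p).target), ?_, ?_⟩
  · rw [← map_extChartAt_symm_nhdsWithin_range (I := I)]
    exact Filter.image_mem_map (Filter.inter_mem hu (extChartAt_target_mem_nhdsWithin p))
  · rintro _ ⟨y, hy, rfl⟩ _ ⟨z, hz, rfl⟩ h
    rw [hui hy.1 hz.1 h]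

theorem map_nhds_eq_of_isInvertible_mfderiv [CompleteSpace E] (hF : ContMDiff I 𝓘(ℝ, E') ∞ F)
    (hd : ∀ p, (mfderiv I 𝓘(ℝ, E') F p).IsInvertible) {p : M} (hp : I.IsInteriorPoint p) :
    Filter.map F (𝓝 p) = 𝓝 (F p) := by
  obtain ⟨A, hA⟩ := exists_equiv_hasFDerivWithinAt_comp_extChartAt_symm hF hd p
    (mem_extChartAt_target p)
  have hr : range I ∈ 𝓝 (extChartAt I p p) := range_mem_nhds_isInteriorPoint hp
  have hn : 𝓝[range I] (extChartAt I p p) = 𝓝 (extChartAt I p p) := nhdsWithin_eq_nhds.2 hr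
  have hf : ContDiffAt ℝ ∞ (F ∘ (extChartAt I p).symm) (extChartAt I p p) :=
    (contDiffOn_comp_extChartAt_symm hF p _ (mem_extChartAt_target p)).contDiffAt
      (hn ▸ extChartAt_target_mem_nhdsWithin p)
  have h := (hf.hasStrictFDerivAt' (hA.hasFDerivAt hr) (by simp)).map_nhds_eq_of_equiv
  rw [← hn, ← Filter.map_map, map_extChartAt_symm_nhdsWithin_range] at h
  simpa using h

/-- A continuous right inverse, on any set `t`, of a smooth map with invertible derivatives is
smooth on `t`, up to the boundary of the manifold. -/
theorem contMDiffOn_of_rightInverse [CompleteSpace E] (hF : ContMDiff I 𝓘(ℝ, E') ∞ F)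
    (hd : ∀ p, (mfderiv I 𝓘(ℝ, E') F p).IsInvertible) {G : E' → M} {t : Set E'}
    (hc : ContinuousOn G t) (hFG : ∀ y ∈ t, F (G y) = y) :
    ContMDiffOn 𝓘(ℝ, E') I ∞ G t := by
  intro y hy
  rw [contMDiffWithinAt_iff_target]
  refine ⟨hc y hy, ContDiffWithinAt.contMDiffWithinAt ?_⟩
  let e := extChartAt I (G y)
  have hn : t ∩ G ⁻¹' e.source ∈ 𝓝[t] y :=
    Filter.inter_mem self_mem_nhdsWithin ((hc y hy) (extChartAt_source_mem_nhds (G y)))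
  refine ContDiffWithinAt.mono_of_mem_nhdsWithin ?_ hn
  refine ContDiffOn.of_rightInverse (f := F ∘ e.symm) (s := e.target)
    (uniqueDiffOn_extChartAt_target _) (contDiffOn_comp_extChartAt_symm hF _) ?_ ?_ ?_ ?_ y
    ⟨hy, mem_extChartAt_source _⟩
  · intro z hz
    obtain ⟨A, hA⟩ := exists_equiv_hasFDerivWithinAt_comp_extChartAt_symm hF hd (G y) hz
    exact ⟨A, hA.mono (extChartAt_target_subset_range _)⟩
  · exact (continuousOn_extChartAt (G y)).comp (hc.mono inter_subset_left) fun z hz => hz.2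
  · exact fun z hz => e.map_source hz.2
  · intro z hz
    simp only [Function.comp_apply]
    rw [e.left_inv hz.2, hFG z hz.1]

end LocalDiffeomorphism

namespace ManifoldWithBoundary

variable {M : Type*} [TopologicalSpace M] [ChartedSpace (EuclideanHalfSpace 3) M]
  [IsManifold (𝓡∂ 3) ∞ M]

/-! ### The coordinates `xⁱ` as a local diffeomorphism -/

theorem compl_boundary_nonempty [Nonempty M] : ((𝓡∂ 3).boundary M)ᶜ.Nonempty := by
  obtain ⟨p⟩ := ‹Nonempty M›
  let e := chartAt (EuclideanHalfSpace 3) p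
  -- Moving from the chart image of `p` inwards by `t` stays in the chart target for small `t`.
  let γ : ℝ → EuclideanHalfSpace 3 := fun t =>
    ⟨(e p).1 + EuclideanSpace.single 0 |t|, by
      have := (e p).2
      simp only [PiLp.add_apply, PiLp.single_apply, if_true]
      positivity⟩
  have hγ : Continuous γ := by
    refine Continuous.subtype_mk ?_ _
    refine continuous_const.add ?_
    exact (PiLp.continuous_toLp 2 _).comp (continuous_pi fun i => by
      by_cases h : i = 0
      · subst h; simpa using continuous_abs
      · simpa [h] using continuous_const)
  have hγ0 : γ 0 = e p := by
    apply Subtype.ext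
    simp [γ]
  have hev : ∀ᶠ t in 𝓝 (0 : ℝ), γ t ∈ e.target :=
    hγ.continuousAt.eventually
      (hγ0 ▸ e.open_target.mem_nhds (e.map_source (mem_chart_source _ p)))
  obtain ⟨t, ht, ht0⟩ :=
    ((hev.filter_mono nhdsWithin_le_nhds).and (self_mem_nhdsWithin (s := Ioi (0 : ℝ)))).exists
  refine ⟨e.symm (γ t), fun h => ?_⟩
  rw [mem_boundary_iff p (e.map_target ht)] at h
  change (e (e.symm (γ t))).1 0 = 0 at h
  rw [e.right_inv ht] at h
  have h1 : 0 ≤ (e p).1 0 := (e p).2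
  have h2 : (0 : ℝ) < |t| := abs_pos.2 (ne_of_gt ht0)
  simp only [γ, PiLp.add_apply, PiLp.single_apply, if_true] at h
  linarith

/-- The bound `one_le_sum_inv_mul_of_neg_eq` for bilinear forms on three-space. The frame `e` and
the matrix `G` are variables so that the sum unifies with the one in `tensorNorm`. -/
theorem one_le_sum_inv_mul_of_bilin_neg_eq (B : E3 →L[ℝ] E3 →L[ℝ] ℝ)
    (hsymm : ∀ u w, B u w = B w u) (hpos : ∀ u, u ≠ 0 → 0 < B u u) (T : E3 →L[ℝ] E3 →L[ℝ] ℝ)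
    {v : E3} (hv : v ≠ 0) (hT : T v v = -B v v) (e : Fin 3 → E3)
    (he : e = fun i => EuclideanSpace.single i 1) (G : Matrix (Fin 3) (Fin 3) ℝ)
    (hG : G = Matrix.of fun i j => B (e i) (e j)) :
    1 ≤ ∑ i, ∑ j, ∑ k, ∑ l, G⁻¹ i k * G⁻¹ j l * T (e i) (e j) * T (e k) (e l) := by
  have hexp (u : E3) : u = ∑ i, u i • e i := by
    have := (EuclideanSpace.basisFun (Fin 3) ℝ).sum_repr u
    simpa [he] using this.symm
  have hq (A : E3 →L[ℝ] E3 →L[ℝ] ℝ) (u : E3) : dotProduct u.ofLp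
      ((Matrix.of fun i j => A (e i) (e j)).mulVec u.ofLp) = A u u := by
    conv_rhs => rw [hexp u]
    simp only [map_sum, map_smul, FunLike.coe_sum, FunLike.coe_smul, Finset.sum_apply,
      Pi.smul_apply, smul_eq_mul, dotProduct, Matrix.mulVec, Matrix.of_apply, Finset.mul_sum]
    rw [Finset.sum_comm]
    exact Finset.sum_congr rfl fun i _ => Finset.sum_congr rfl fun j _ => by ring
  refine one_le_sum_inv_mul_of_neg_eq (T := Matrix.of fun i j => T (e i) (e j)) (v := v.ofLp)
    ?_ (fun h => hv (by ext i; simp [h])) (by rw [hG, hq, hq, hT])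
  refine Matrix.PosDef.of_dotProduct_mulVec_pos ?_ fun u hu => ?_
  · ext i j
    simp [hG, hsymm (e i) (e j)]
  · have h := hpos (WithLp.toLp 2 u) (fun h => hu (by simpa using h))
    rw [← hq] at h
    simpa [hG] using h

/-- A vector `v` annihilated by all `dxⁱ` satisfies `(∑ᵢ dxⁱ ⊗ dxⁱ - g) v v = -g v v`, which the
bound on the norm excludes unless `v = 0`. -/
theorem eq_zero_of_mvfderiv_eq_zero {g : SmoothMetric M} {x : Fin 3 → M → ℝ} {p : M}
    (hp : tensorNorm g p (gramDefect g x p) < 1) {v : TangentSpace (𝓡∂ 3) p}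
    (hv : ∀ i, mvfderiv (𝓡∂ 3) (x i) p v = 0) : v = 0 := by
  by_contra hv0
  -- The tangent space is `E3` by definition; the ascriptions below let `simp` see it as such.
  let B : E3 →L[ℝ] E3 →L[ℝ] ℝ := g.inner p
  let L (i : Fin 3) : E3 →L[ℝ] ℝ := mvfderiv (𝓡∂ 3) (x i) p
  let T : E3 →L[ℝ] E3 →L[ℝ] ℝ := ∑ i, (L i).smulRight (L i) - B
  have hT (u w : E3) : T u w = ∑ i, L i u * L i w - B u w := by
    simp [T]
  have hTapp (u w : E3) : T u w = gramDefect g x p u w := hT u w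
  have hL (i : Fin 3) : L i v = 0 := hv i
  have h1 := one_le_sum_inv_mul_of_bilin_neg_eq B (g.symm p) (g.pos p) T (v := v) hv0
    ((hT v v).trans (by simp only [hL]; simp)) _ rfl _ rfl
  simp only [hTapp] at h1
  exact absurd hp (not_lt.2 (Real.one_le_sqrt.2 h1))

theorem isInvertible_mfderiv_of_tensorNorm_lt_one {g : SmoothMetric M} {x : Fin 3 → M → ℝ}
    {p : M} (hp : tensorNorm g p (gramDefect g x p) < 1) {F : M → E3}
    (hF : ContMDiff (𝓡∂ 3) 𝓘(ℝ, E3) ∞ F) (hFx : ∀ i q, F q i = x i q) :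
    (mfderiv (𝓡∂ 3) 𝓘(ℝ, E3) F p).IsInvertible := by
  let A : E3 →L[ℝ] E3 := mfderiv (𝓡∂ 3) 𝓘(ℝ, E3) F p
  have hA (i : Fin 3) (v : E3) : A v i = mvfderiv (𝓡∂ 3) (x i) p v := by
    have h1 := (hF.mdifferentiable (by simp) p).hasMFDerivAt
    have h2 := ((EuclideanSpace.proj i : E3 →L[ℝ] ℝ).hasMFDerivAt (x := F p)).comp p h1
    have h3 : (EuclideanSpace.proj i : E3 →L[ℝ] ℝ) ∘ F = x i := funext fun q => hFx i q
    rw [h3] at h2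
    rw [mvfderiv, h2.mfderiv]
    rfl
  have hinj : Function.Injective A := by
    rw [injective_iff_map_eq_zero]
    intro v hv
    exact eq_zero_of_mvfderiv_eq_zero hp fun i => by
      rw [← hA i v, hv]
      rfl
  exact ⟨(LinearEquiv.ofInjectiveEndo A.toLinearMap hinj).toContinuousLinearEquiv, by
    ext v; rfl⟩

end ManifoldWithBoundary

/-! ### The diffeomorphism onto the ball -/

open ManifoldWithBoundary
theorem proposition8p1 {M : Type*} [TopologicalSpace M] [T2Space M] [CompactSpace M]
    [ConnectedSpace M] [ChartedSpace (EuclideanHalfSpace 3) M] [IsManifold (𝓡∂ 3) ∞ M]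
    (g : SmoothMetric M)
    (Φ : Bdry M ≃ₘ⟮𝓡 2, 𝓡 2⟯ S2) (hΦ : IsConformalIso g Φ)
    (x : Fin 3 → M → ℝ)
    (hx_smooth : ∀ i, ContMDiff (𝓡∂ 3) 𝓘(ℝ, ℝ) ∞ (x i))
    (hx_harmonic : ∀ i p, laplacian g (x i) p = 0)
    (hx_bdry : ∀ i (p : Bdry M), x i p = (Φ p : E3) i)
    (hB : ∀ p, tensorNorm g p (gramDefect g x p) < 1) :
    IsDiffeomorphismOnto (fun p => !₂[x 0 p, x 1 p, x 2 p]) (Metric.closedBall (0 : E3) 1) := by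
  set F : M → E3 := fun p => !₂[x 0 p, x 1 p, x 2 p]
  have hFx (i : Fin 3) (q : M) : F q i = x i q := by fin_cases i <;> rfl
  have hF : ContMDiff (𝓡∂ 3) 𝓘(ℝ, E3) ∞ F := by
    have h : ContMDiff (𝓡∂ 3) 𝓘(ℝ, Fin 3 → ℝ) ∞ fun q i => x i q :=
      contMDiff_pi_space.2 hx_smooth
    convert! (EuclideanSpace.equiv (Fin 3) ℝ).symm.toContinuousLinearMap.contMDiff.comp h using 1
    ext q i
    exact hFx i q
  have hd (p : M) := isInvertible_mfderiv_of_tensorNorm_lt_one (hB p) hF hFx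
  have hFΦ (p : Bdry M) : F p = (Φ p : E3) := by
    ext i
    rw [hFx, hx_bdry]
  have hbdry : BijOn F ((𝓡∂ 3).boundary M) (Metric.sphere 0 1) := by
    refine ⟨fun p hp => hFΦ ⟨p, hp⟩ ▸ (Φ ⟨p, hp⟩).2, fun p hp q hq h => ?_, fun y hy => ?_⟩
    · have h' : Φ ⟨p, hp⟩ = Φ ⟨q, hq⟩ :=
        Subtype.ext ((hFΦ ⟨p, hp⟩).symm.trans (h.trans (hFΦ ⟨q, hq⟩)))
      exact congrArg Subtype.val (Φ.injective h')
    · obtain ⟨p, hp⟩ := Φ.surjective ⟨y, hy⟩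
      exact ⟨p, p.2, (hFΦ p).trans (congrArg Subtype.val hp)⟩
  have hbij : BijOn F univ (Metric.closedBall 0 1) :=
    bijOn_closedBall_of_locally_injective hF.continuous
      (exists_injOn_nhds_of_isInvertible_mfderiv hF hd)
      (fun p hp => map_nhds_eq_of_isInvertible_mfderiv hF hd
        (((𝓡∂ 3).isInteriorPoint_iff_not_isBoundaryPoint p).2 hp))
      compl_boundary_nonempty hbdry
  have hinj : Function.Injective F := injOn_univ.1 hbij.injOn
  refine ⟨hF, hbij, Function.invFun F, ?_, Function.leftInverse_invFun hinj⟩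
  have hFG (y : E3) (hy : y ∈ Metric.closedBall (0 : E3) 1) : F (Function.invFun F y) = y := by
    obtain ⟨p, -, hp⟩ := hbij.surjOn hy
    exact Function.invFun_eq ⟨p, hp⟩
  refine contMDiffOn_of_rightInverse hF hd ?_ hFG
  -- A continuous injection of a compact space is an embedding.
  rw [((hF.continuous.isClosedEmbedding hinj).isInducing).continuousOn_iff]
  exact continuousOn_id.congr hFG
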